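/- Model and algorithm. Let $G=(V,E)$ be a finite graph with $n$ vertices, and let every vertex $v$ be given a maximum level $\ell_{\max}(v)\in\mathbb N$. In the synchronous full-duplex beeping model with two channels, in every round each vertex may send a signal on channel 1 and/or on channel 2 to all its neighbours, and then learns, for each channel separately, only whether at least one neighbour sent a signal on it. Every vertex $v$ holds a level $\ell(v)\in\{0,\dots,\ell_{\max}(v)\}$. In each round: * if $0<\ell(v)<\ell_{\max}(v)$, then $v$ signals on channel 1 with probability $2^{-\ell(v)}$, independently of everything else; otherwise it does not signal on channel 1; * $v$ signals on channel 2 if and only if $\ell(v)=0$; * then $v$ updates its level: if it received a signal on channel 2, $\ell(v)\gets\ell_{\max}(v)$; else if it received a signal on channel 1 and did not itself signal on channel 2, $\ell(v)\gets\min\{\ell(v)+1,\ell_{\max}(v)\}$; else if it signalled on channel 1, $\ell(v)\gets 0$; else if it did not signal on channel 2, $\ell(v)\gets\max\{\ell(v)-1,1\}$; else $\ell(v)$ is unchanged. Level $0$ means "in the MIS" and level $\ell_{\max}(v)$ means "not in the MIS". Let $\deg_2(v)$ be the maximum degree of the vertices in $N^+(v)=N(v)\cup\{v\}$, let $\log$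 be the logarithm to base 2, and put $\log 0:=0$ (relevant only for isolated vertices). Claim. For all constants $c_1\ge 15$, $c_2>0$ and $a>0$ there is a constant $M>0$ such that the following holds for every finite graph $G$ with $n$ vertices and all maximum levels with $$2\log\deg_2(v)+c_1\ \le\ \ell_{\max}(v)\ \le\ c_2\log n\qquad\text{for every }v\in V.$$ From every initial configuration with $0\le\ell_0(v)\le\ell_{\max}(v)$ for all $v$, with probability at least $1-n^{-a}$ the algorithm stabilizes to a maximal independent set within $M\log n$ rounds; that is, there is a maximal independent set $I$ of $G$ such that after every number $t\ge M\log n$ of rounds, every $v\in I$ has level $0$ and every $v\notin I$ has level $\ell_{\max}(v)$. -/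

import Mathlib

open MeasureTheory

namespace TwoChannelMIS

variable {V : Type*}

/-- The maximum degree of a vertex in the closed neighbourhood of `v`. -/
noncomputable def deg₂ [Fintype V] (G : SimpleGraph V) (v : V) : ℕ :=
  open Classical in (insert v (G.neighborFinset v)).sup fun u => G.degree u

/-- `v` signals on the first channel: only if `0 < ℓ v < ℓmax v`, and then exactly when its
fresh uniform random number `r v` in `[0, 1]` is below `2 ^ (-ℓ v)`. -/
def Beep₁ (ℓmax ℓ : V → ℕ) (r : V → unitInterval) (v : V) : Prop :=
  0 < ℓ v ∧ ℓ v < ℓmax v ∧ (r v : ℝ) < (1 / 2 : ℝ) ^ ℓ v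

/-- `v` signals on the second channel: exactly when its level is `0`. -/
def Beep₂ (ℓ : V → ℕ) (v : V) : Prop := ℓ v = 0

/-- `v` receives a signal: at least one neighbour sends it. -/
def Hears (G : SimpleGraph V) (sends : V → Prop) (v : V) : Prop := ∃ u, G.Adj v u ∧ sends u

open Classical in
/-- The local update rule of a vertex with maximum level `m` and level `l`, given which signals
it sent (`b₁`, `b₂`) and which it received (`h₁`, `h₂`). A vertex that signals on the second
channel keeps its level unless it receives a signal on the second channel. -/
noncomputable def update (m l : ℕ) (b₁ b₂ h₁ h₂ : Prop) : ℕ :=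
  if h₂ then m
  else if h₁ ∧ ¬ b₂ then min (l + 1) m
  else if b₁ then 0
  else if ¬ b₂ then max (l - 1) 1
  else l

/-- One synchronous round. -/
noncomputable def step (G : SimpleGraph V) (ℓmax ℓ : V → ℕ) (r : V → unitInterval) : V → ℕ :=
  fun v => update (ℓmax v) (ℓ v) (Beep₁ ℓmax ℓ r v) (Beep₂ ℓ v)
    (Hears G (Beep₁ ℓmax ℓ r) v) (Hears G (Beep₂ ℓ) v)

/-- The levels after `t` rounds, started from `ℓ₀`, with `ω t` the random numbers that the
vertices use in the round that leads from time `t` to time `t + 1`. -/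
noncomputable def level (G : SimpleGraph V) (ℓmax ℓ₀ : V → ℕ) (ω : ℕ → V → unitInterval) :
    ℕ → V → ℕ
  | 0 => ℓ₀
  | t + 1 => step G ℓmax (level G ℓmax ℓ₀ ω t) (ω t)

/-- The law of the random numbers: independent over rounds and vertices, each uniform on
`[0, 1]`. -/
noncomputable def randomness (V : Type*) [Fintype V] : Measure (ℕ → V → unitInterval) :=
  Measure.infinitePi fun _ : ℕ => Measure.pi fun _ : V => (volume : Measure unitInterval)

/-- At time `t` the levels `L` encode the set `I` (level `0` inside `I`, maximum level outside). -/
def Encodes (ℓmax : V → ℕ) (L : V → ℕ) (I : Set V) : Prop :=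
  (∀ v ∈ I, L v = 0) ∧ ∀ v ∉ I, L v = ℓmax v

/-- The trajectory `L` has stabilized to a maximal independent set by time `s`: one and the same
maximal independent set is encoded at all times from `s` on. -/
def StabilizedBy (G : SimpleGraph V) (ℓmax : V → ℕ) (L : ℕ → V → ℕ) (s : ℝ) : Prop :=
  ∃ I : Set V, Maximal G.IsIndepSet I ∧ ∀ t : ℕ, s ≤ t → Encodes ℓmax (L t) I

end TwoChannelMIS

/-
A vertex is decided once it or one of its neighbours has level `0`. After the first round the set of
the vertices of level `0` is independent and from then on it can only grow; as soon as all vertices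
are decided it is maximal, and one more round sends all other vertices to their maximum levels.

An undecided vertex `v` is followed through the potential `((6 / 5) ^ ℓ v * (1 + 10 d)) ^ β`, where
`d` is the expected number of neighbours of `v` that signal on the first channel and `β` is a tiny
exponent. If quiet neighbours contribute a fixed amount to `d`, or if `ℓ v = 1` and `d` is small,
then `v` is decided in the next round with probability bounded below, and since `β` is tiny this
outweighs every possible growth of the potential. Otherwise the other neighbours, which very likely
hear a signal and then halve their signalling probabilities, nearly halve a large `d` in
expectation; and if `d` is small, then `v` very likely hears nothing and lowers its level. So the
expected potential shrinks by a constant factor in every round. It is at most polynomial in `n`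
after the first round and at least `1` as long as `v` is undecided, so Markov's inequality and a
union bound over the vertices leave a probability of at most `n ^ (-a)` after `O(log n)` rounds.
-/

namespace TwoChannelMIS

section Inequalities

theorem prod_one_sub_le_inv_one_add_sum {ι : Type*} {p : ι → ℝ} {s : Finset ι}
    (h0 : ∀ i ∈ s, 0 ≤ p i) (h1 : ∀ i ∈ s, p i ≤ 1) :
    ∏ i ∈ s, (1 - p i) ≤ (1 + ∑ i ∈ s, p i)⁻¹ := by
  have hsum : 0 ≤ ∑ i ∈ s, p i := Finset.sum_nonneg h0
  calc ∏ i ∈ s, (1 - p i) ≤ ∏ i ∈ s, Real.exp (-p i) :=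
        Finset.prod_le_prod (fun i hi => sub_nonneg.2 (h1 i hi))
          fun i _ => Real.one_sub_le_exp_neg _
    _ = (Real.exp (∑ i ∈ s, p i))⁻¹ := by
        rw [← Real.exp_sum, Finset.sum_neg_distrib, Real.exp_neg]
    _ ≤ (1 + ∑ i ∈ s, p i)⁻¹ :=
        inv_anti₀ (by positivity) (by linarith [Real.add_one_le_exp (∑ i ∈ s, p i)])

theorem pow_le_rpow_neg_of_div_logb_mul_le {η n s : ℝ} {T : ℕ} (hη0 : 0 < η) (hη1 : η < 1)
    (hn : 0 < n) (hT : s / -Real.logb 2 η * Real.logb 2 n ≤ T) : η ^ T ≤ n ^ (-s) := by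
  have hlog : 0 < -Real.logb 2 η := neg_pos.2 (Real.logb_neg one_lt_two hη0 hη1)
  calc η ^ T = (2 : ℝ) ^ (Real.logb 2 η * T) := by
        rw [Real.rpow_mul zero_le_two, Real.rpow_logb two_pos (by norm_num) hη0,
          Real.rpow_natCast]
    _ ≤ 2 ^ (Real.logb 2 n * -s) := by
        refine Real.rpow_le_rpow_of_exponent_le one_le_two ?_
        have hmul := mul_le_mul_of_nonneg_left hT hlog.le
        rw [← mul_assoc, mul_div_cancel₀ _ hlog.ne'] at hmul
        linarith
    _ = n ^ (-s) := by
        rw [Real.rpow_mul zero_le_two, Real.rpow_logb two_pos (by norm_num) hn]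

theorem two_pow_le_rpow_of_le_mul_logb {n c : ℝ} {m : ℕ} (hn : 0 < n)
    (hm : (m : ℝ) ≤ c * Real.logb 2 n) : (2 : ℝ) ^ m ≤ n ^ c := by
  calc (2 : ℝ) ^ m = 2 ^ (m : ℝ) := (Real.rpow_natCast _ _).symm
    _ ≤ 2 ^ (Real.logb 2 n * c) :=
        Real.rpow_le_rpow_of_exponent_le one_le_two (by linarith)
    _ = n ^ c := by rw [Real.rpow_mul zero_le_two, Real.rpow_logb two_pos (by norm_num) hn]

end Inequalities

section Integrals

variable {Ω : Type*} [MeasurableSpace Ω] {μ : Measure Ω}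

theorem integral_le_integral_add_mul_measureReal [IsFiniteMeasure μ] {F H : Ω → ℝ} {S : Set Ω}
    {c : ℝ} (hF : Integrable F μ) (hH : Integrable H μ) (hS : MeasurableSet S)
    (hout : ∀ x ∉ S, F x ≤ H x) (hin : ∀ x ∈ S, F x ≤ H x + c) :
    ∫ x, F x ∂μ ≤ ∫ x, H x ∂μ + c * μ.real S := by
  have hind : Integrable (S.indicator fun _ => c) μ := (integrable_const c).indicator hS
  calc ∫ x, F x ∂μ ≤ ∫ x, (H x + S.indicator (fun _ => c) x) ∂μ := by
        refine integral_mono hF (hH.add hind) fun x => ?_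
        by_cases hx : x ∈ S
        · simpa only [Set.indicator_of_mem hx] using hin x hx
        · simpa only [Set.indicator_of_notMem hx, add_zero] using hout x hx
    _ = ∫ x, H x ∂μ + c * μ.real S := by
        rw [integral_add hH hind, integral_indicator_const c hS, smul_eq_mul, mul_comm c]

variable [IsProbabilityMeasure μ] {X : Ω → ℝ} {Y β : ℝ}

theorem integral_rpow_le_rpow_mul_rpow {ρ : ℝ} (hX0 : 0 ≤ X) (hX : Integrable X μ)
    (hXβ : Integrable (fun x => X x ^ β) μ) (hβ0 : 0 ≤ β) (hβ1 : β ≤ 1) (hρ : 0 ≤ ρ) (hY : 0 ≤ Y)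
    (h : ∫ x, X x ∂μ ≤ ρ * Y) : ∫ x, X x ^ β ∂μ ≤ ρ ^ β * Y ^ β := by
  calc ∫ x, X x ^ β ∂μ ≤ (∫ x, X x ∂μ) ^ β :=
        (Real.concaveOn_rpow hβ0 hβ1).le_map_integral
          (Real.continuous_rpow_const hβ0).continuousOn isClosed_Ici
          (Filter.Eventually.of_forall hX0) hX hXβ
    _ ≤ (ρ * Y) ^ β := Real.rpow_le_rpow (integral_nonneg hX0) h hβ0
    _ = ρ ^ β * Y ^ β := Real.mul_rpow hρ hY

theorem integral_rpow_le_of_le_measureReal {S : Set Ω} {K κ : ℝ} (hX0 : 0 ≤ X)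
    (hXβ : Integrable (fun x => X x ^ β) μ) (hβ : 0 < β) (hK : 0 ≤ K) (hY : 0 ≤ Y)
    (hS : MeasurableSet S) (hzero : ∀ x ∈ S, X x = 0) (hκ : κ ≤ μ.real S)
    (hle : ∀ x, X x ≤ K * Y) : ∫ x, X x ^ β ∂μ ≤ K ^ β * (1 - κ) * Y ^ β := by
  have hbound := integral_le_integral_add_mul_measureReal (H := 0) (c := K ^ β * Y ^ β) hXβ
    (integrable_zero _ _ _) hS.compl
    (fun x hx => by simp [hzero x (not_not.1 hx), Real.zero_rpow hβ.ne'])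
    (fun x _ => by
      rw [Pi.zero_apply, zero_add, ← Real.mul_rpow hK hY]
      exact Real.rpow_le_rpow (hX0 x) (hle x) hβ.le)
  rw [probReal_compl_eq_one_sub hS, Pi.zero_def, integral_zero, zero_add] at hbound
  calc ∫ x, X x ^ β ∂μ ≤ K ^ β * Y ^ β * (1 - μ.real S) := hbound
    _ ≤ K ^ β * Y ^ β * (1 - κ) := by gcongr
    _ = K ^ β * (1 - κ) * Y ^ β := by ring

end Integrals

section Dynamics

variable {V : Type*} {G : SimpleGraph V} {ℓmax ℓ : V → ℕ} {b : V → Prop} {v : V}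

/-- The set of the vertices of level `0`: those that consider themselves in the independent set. -/
def zeroSet (ℓ : V → ℕ) : Set V := {v | ℓ v = 0}

/-- The vertex `v` is decided: it or one of its neighbours has level `0`. -/
def Dominated (G : SimpleGraph V) (ℓ : V → ℕ) (v : V) : Prop :=
  v ∈ zeroSet ℓ ∨ Hears G (Beep₂ ℓ) v

/-- The levels after a round in which exactly the vertices satisfying `b` signal on the first
channel. The randomness of a round acts only through `b`, which ranges over a finite type. -/
noncomputable def nextLevel (G : SimpleGraph V) (ℓmax ℓ : V → ℕ) (b : V → Prop) : V → ℕ :=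
  fun v => update (ℓmax v) (ℓ v) (b v) (Beep₂ ℓ v) (Hears G b v) (Hears G (Beep₂ ℓ) v)

theorem level_succ (G : SimpleGraph V) (ℓmax ℓ : V → ℕ) (ω : ℕ → V → unitInterval) (t : ℕ) :
    level G ℓmax ℓ ω (t + 1) =
      nextLevel G ℓmax (level G ℓmax ℓ ω t) (Beep₁ ℓmax (level G ℓmax ℓ ω t) (ω t)) := rfl

theorem nextLevel_of_hears₂ (h₂ : Hears G (Beep₂ ℓ) v) : nextLevel G ℓmax ℓ b v = ℓmax v := by
  simp [nextLevel, update, h₂]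

theorem nextLevel_of_zero (h₂ : ¬ Hears G (Beep₂ ℓ) v) (h0 : ℓ v = 0) :
    nextLevel G ℓmax ℓ b v = 0 := by
  have hbeep : Beep₂ ℓ v := h0
  simp [nextLevel, update, h₂, hbeep, h0]

theorem nextLevel_of_hears₁ (h₂ : ¬ Hears G (Beep₂ ℓ) v) (h0 : ℓ v ≠ 0) (h₁ : Hears G b v) :
    nextLevel G ℓmax ℓ b v = min (ℓ v + 1) (ℓmax v) := by
  have hbeep : ¬ Beep₂ ℓ v := h0
  simp [nextLevel, update, h₂, hbeep, h₁]

theorem nextLevel_of_beep_alone (h₂ : ¬ Hears G (Beep₂ ℓ) v) (hb : b v) (h₁ : ¬ Hears G b v) :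
    nextLevel G ℓmax ℓ b v = 0 := by
  simp [nextLevel, update, h₂, hb, h₁]

theorem nextLevel_of_silent (h₂ : ¬ Hears G (Beep₂ ℓ) v) (h0 : ℓ v ≠ 0) (hb : ¬ b v)
    (h₁ : ¬ Hears G b v) : nextLevel G ℓmax ℓ b v = max (ℓ v - 1) 1 := by
  have hbeep : ¬ Beep₂ ℓ v := h0
  simp [nextLevel, update, h₂, hbeep, hb, h₁]

theorem nextLevel_le (hpos : 0 < ℓmax v) (hle : ℓ v ≤ ℓmax v) :
    nextLevel G ℓmax ℓ b v ≤ ℓmax v := by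
  unfold nextLevel update
  split_ifs <;> omega

theorem level_le (hpos : ∀ v, 0 < ℓmax v) (hle : ∀ v, ℓ v ≤ ℓmax v) (ω : ℕ → V → unitInterval)
    (t : ℕ) (v : V) : level G ℓmax ℓ ω t v ≤ ℓmax v := by
  induction t with
  | zero => exact hle v
  | succ t ih => exact nextLevel_le (hpos v) ih

theorem level_le_nextLevel_add_one (hle : ℓ v ≤ ℓmax v) (h : nextLevel G ℓmax ℓ b v ≠ 0) :
    ℓ v ≤ nextLevel G ℓmax ℓ b v + 1 := by
  unfold nextLevel update at *
  split_ifs at * <;> omega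

theorem nextLevel_le_level_add_one (hv : ¬ Dominated G ℓ v) :
    nextLevel G ℓmax ℓ b v ≤ ℓ v + 1 := by
  have h₂ := (not_or.1 hv).2
  simp only [nextLevel, update, if_neg h₂]
  split_ifs <;> omega

theorem not_hears₂_of_mem_zeroSet (h : G.IsIndepSet (zeroSet ℓ)) (hv : v ∈ zeroSet ℓ) :
    ¬ Hears G (Beep₂ ℓ) v :=
  fun ⟨_, huv, hu⟩ => h hv hu huv.ne huv

theorem zeroSet_subset_zeroSet_nextLevel (h : G.IsIndepSet (zeroSet ℓ)) :
    zeroSet ℓ ⊆ zeroSet (nextLevel G ℓmax ℓ b) :=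
  fun _ hv => nextLevel_of_zero (not_hears₂_of_mem_zeroSet h hv) hv

theorem not_hears₂_and_of_nextLevel_eq_zero (hpos : 0 < ℓmax v)
    (hv : nextLevel G ℓmax ℓ b v = 0) :
    ¬ Hears G (Beep₂ ℓ) v ∧ (ℓ v = 0 ∨ b v ∧ ¬ Hears G b v) := by
  have h₂ : ¬ Hears G (Beep₂ ℓ) v := fun h =>
    hpos.ne' ((nextLevel_of_hears₂ h).symm.trans hv)
  refine ⟨h₂, or_iff_not_imp_left.2 fun h0 => ?_⟩
  have h₁ : ¬ Hears G b v := fun h => by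
    rw [nextLevel_of_hears₁ h₂ h0 h] at hv
    omega
  refine ⟨by_contra fun hb => ?_, h₁⟩
  rw [nextLevel_of_silent h₂ h0 hb h₁] at hv
  omega

/- Two adjacent vertices cannot both signal alone, and a vertex next to a vertex of level `0` is
thrown to its maximum level; so independence holds after any round, whatever the levels before. -/
theorem isIndepSet_zeroSet_nextLevel (hpos : ∀ v, 0 < ℓmax v) :
    G.IsIndepSet (zeroSet (nextLevel G ℓmax ℓ b)) := by
  intro u hu v hv _ huv
  obtain ⟨hu₂, hu0 | ⟨hub, -⟩⟩ := not_hears₂_and_of_nextLevel_eq_zero (hpos u) hu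
  · exact (not_hears₂_and_of_nextLevel_eq_zero (hpos v) hv).1 ⟨u, huv.symm, hu0⟩
  · obtain ⟨-, hv0 | ⟨-, hv₁⟩⟩ := not_hears₂_and_of_nextLevel_eq_zero (hpos v) hv
    · exact hu₂ ⟨v, huv, hv0⟩
    · exact hv₁ ⟨u, huv.symm, hub⟩

theorem Dominated.nextLevel (h : G.IsIndepSet (zeroSet ℓ)) (hv : Dominated G ℓ v) :
    Dominated G (nextLevel G ℓmax ℓ b) v :=
  hv.imp (fun hv => zeroSet_subset_zeroSet_nextLevel h hv)
    fun ⟨u, huv, hu⟩ => ⟨u, huv, zeroSet_subset_zeroSet_nextLevel h hu⟩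

theorem maximal_isIndepSet_zeroSet_iff :
    Maximal G.IsIndepSet (zeroSet ℓ) ↔ G.IsIndepSet (zeroSet ℓ) ∧ ∀ v, Dominated G ℓ v := by
  refine ⟨fun h => ⟨h.prop, fun v => ?_⟩, fun ⟨h, hdom⟩ => ⟨h, fun J hJ hsub v hv => ?_⟩⟩
  · rw [Dominated, or_iff_not_imp_right]
    intro h₂
    have hins : G.IsIndepSet (insert v (zeroSet ℓ)) :=
      Set.pairwise_insert.2 ⟨h.prop, fun u hu _ =>
        ⟨fun hvu => h₂ ⟨u, hvu, hu⟩, fun huv => h₂ ⟨u, huv.symm, hu⟩⟩⟩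
    exact h.mem_of_prop_insert hins
  · exact (hdom v).resolve_right fun ⟨u, hvu, hu⟩ => hJ hv (hsub hu) hvu.ne hvu

theorem encodes_nextLevel (h : Maximal G.IsIndepSet (zeroSet ℓ)) :
    Encodes ℓmax (nextLevel G ℓmax ℓ b) (zeroSet ℓ) :=
  ⟨fun _ hv => zeroSet_subset_zeroSet_nextLevel h.prop hv, fun v hv =>
    nextLevel_of_hears₂ (((maximal_isIndepSet_zeroSet_iff.1 h).2 v).resolve_left hv)⟩

theorem zeroSet_nextLevel_eq (hpos : ∀ v, 0 < ℓmax v) (h : Maximal G.IsIndepSet (zeroSet ℓ)) :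
    zeroSet (nextLevel G ℓmax ℓ b) = zeroSet ℓ :=
  (h.eq_of_subset (isIndepSet_zeroSet_nextLevel hpos)
    (zeroSet_subset_zeroSet_nextLevel h.prop)).symm

theorem StabilizedBy.mono {L : ℕ → V → ℕ} {s s' : ℝ} (h : StabilizedBy G ℓmax L s)
    (hs : s ≤ s') : StabilizedBy G ℓmax L s' :=
  h.imp fun _ hI => ⟨hI.1, fun t ht => hI.2 t (hs.trans ht)⟩

theorem StabilizedBy.of_isEmpty [IsEmpty V] (L : ℕ → V → ℕ) (s : ℝ) : StabilizedBy G ℓmax L s :=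
  ⟨∅, ⟨Set.pairwise_empty _, fun _ _ _ v => isEmptyElim v⟩, fun _ _ => ⟨isEmptyElim, isEmptyElim⟩⟩

theorem stabilizedBy_of_maximal_zeroSet {ω : ℕ → V → unitInterval} {T : ℕ}
    (hpos : ∀ v, 0 < ℓmax v)
    (h : Maximal G.IsIndepSet (zeroSet (level G ℓmax ℓ ω T))) :
    StabilizedBy G ℓmax (level G ℓmax ℓ ω) (T + 1) := by
  have hconst : ∀ k, zeroSet (level G ℓmax ℓ ω (T + k)) = zeroSet (level G ℓmax ℓ ω T) := by
    intro k
    induction k with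
    | zero => rfl
    | succ k ih =>
      rw [← ih, ← add_assoc, level_succ]
      exact zeroSet_nextLevel_eq hpos (ih ▸ h)
  refine ⟨_, h, fun t ht => ?_⟩
  obtain ⟨k, rfl⟩ : ∃ k, t = T + k + 1 :=
    (Nat.exists_eq_add_of_le (show T + 1 ≤ t by exact_mod_cast ht)).imp fun k hk => by omega
  rw [← hconst k, level_succ]
  exact encodes_nextLevel ((hconst k).symm ▸ h)

end Dynamics

section Beeps

variable {V : Type*} {ℓmax ℓ : V → ℕ} {v : V}

/-- The probability that a vertex signals on the first channel. -/
noncomputable def beepProb (ℓmax ℓ : V → ℕ) (v : V) : ℝ :=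
  if 0 < ℓ v ∧ ℓ v < ℓmax v then (1 / 2) ^ ℓ v else 0

theorem beepProb_nonneg : 0 ≤ beepProb ℓmax ℓ v := by
  unfold beepProb
  split_ifs <;> positivity

theorem beepProb_le_half : beepProb ℓmax ℓ v ≤ 1 / 2 := by
  unfold beepProb
  split_ifs with h
  · exact pow_le_of_le_one (by norm_num) (by norm_num) h.1.ne'
  · norm_num

theorem one_sub_beepProb_nonneg : 0 ≤ 1 - beepProb ℓmax ℓ v := by
  linarith [beepProb_le_half (ℓmax := ℓmax) (ℓ := ℓ) (v := v)]

theorem one_sub_beepProb_le_one : 1 - beepProb ℓmax ℓ v ≤ 1 :=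
  sub_le_self 1 beepProb_nonneg

/-- The values of its random number for which `v` signals on the first channel. -/
def beepSet (ℓmax ℓ : V → ℕ) (v : V) : Set unitInterval :=
  {x | 0 < ℓ v ∧ ℓ v < ℓmax v ∧ (x : ℝ) < (1 / 2) ^ ℓ v}

theorem measurableSet_beepSet : MeasurableSet (beepSet ℓmax ℓ v) :=
  .inter (.const _) (.inter (.const _) (measurableSet_lt measurable_subtype_coe measurable_const))

theorem measurable_beep₁ (ℓmax ℓ : V → ℕ) : Measurable (Beep₁ ℓmax ℓ) :=
  measurable_pi_lambda _ fun v =>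
    (measurableSet_beepSet (ℓmax := ℓmax) (ℓ := ℓ)).mem.comp (measurable_pi_apply v)

theorem volume_real_beepSet :
    (volume : Measure unitInterval).real (beepSet ℓmax ℓ v) = beepProb ℓmax ℓ v := by
  unfold beepProb
  split_ifs with h
  · have hle : ((1 : ℝ) / 2) ^ ℓ v ≤ 1 := pow_le_one₀ (by norm_num) (by norm_num)
    have hset : beepSet ℓmax ℓ v = Set.Iio ⟨(1 / 2) ^ ℓ v, by positivity, hle⟩ := by
      ext x
      simp [beepSet, h.1, h.2, ← Subtype.coe_lt_coe]
    rw [hset, measureReal_def, unitInterval.volume_Iio, ENNReal.toReal_ofReal (by positivity)]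
  · have hset : beepSet ℓmax ℓ v = ∅ :=
      Set.eq_empty_of_forall_notMem fun x hx => h ⟨hx.1, hx.2.1⟩
    rw [hset, measureReal_empty]

variable [Fintype V]

/-- The law of the set of vertices that signal on the first channel in one round. -/
noncomputable def beepLaw (ℓmax ℓ : V → ℕ) : Measure (V → Prop) :=
  (Measure.pi fun _ : V => (volume : Measure unitInterval)).map (Beep₁ ℓmax ℓ)

instance : IsProbabilityMeasure (beepLaw ℓmax ℓ) :=
  Measure.isProbabilityMeasure_map (measurable_beep₁ ℓmax ℓ).aemeasurable

theorem measureReal_beepLaw_silent (S : Finset V) :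
    (beepLaw ℓmax ℓ).real {b | ∀ u ∈ S, ¬ b u} = ∏ u ∈ S, (1 - beepProb ℓmax ℓ u) := by
  have hpre : Beep₁ ℓmax ℓ ⁻¹' {b | ∀ u ∈ S, ¬ b u} =
      (S : Set V).pi fun u => (beepSet ℓmax ℓ u)ᶜ := rfl
  rw [measureReal_def, beepLaw, Measure.map_apply (measurable_beep₁ ℓmax ℓ)
    (Set.to_countable _).measurableSet, hpre, Measure.pi_pi_finset, ENNReal.toReal_prod]
  refine Finset.prod_congr rfl fun u _ => ?_
  rw [← measureReal_def, probReal_compl_eq_one_sub measurableSet_beepSet, volume_real_beepSet]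

theorem measureReal_beepLaw_beep_silent {S : Finset V} (hv : v ∉ S) :
    (beepLaw ℓmax ℓ).real {b | b v ∧ ∀ u ∈ S, ¬ b u} =
      beepProb ℓmax ℓ v * ∏ u ∈ S, (1 - beepProb ℓmax ℓ u) := by
  classical
  have hset : {b : V → Prop | b v ∧ ∀ u ∈ S, ¬ b u} =
      {b | ∀ u ∈ S, ¬ b u} \ {b | ∀ u ∈ insert v S, ¬ b u} := by
    ext b
    simp only [Finset.forall_mem_insert, Set.mem_sdiff, Set.mem_ofPred_eq]
    tauto
  have hsub : {b : V → Prop | ∀ u ∈ insert v S, ¬ b u} ⊆ {b | ∀ u ∈ S, ¬ b u} :=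
    Set.ofPred_subset_ofPred.2 fun b hb u hu => hb u (Finset.mem_insert_of_mem hu)
  rw [hset, measureReal_sdiff hsub (Set.to_countable _).measurableSet, measureReal_beepLaw_silent,
    measureReal_beepLaw_silent, Finset.prod_insert hv]
  ring

theorem measureReal_beepLaw_beep (v : V) :
    (beepLaw ℓmax ℓ).real {b | b v} = beepProb ℓmax ℓ v := by
  simpa using measureReal_beepLaw_beep_silent (ℓmax := ℓmax) (ℓ := ℓ) (Finset.notMem_empty v)

open scoped Classical

variable (G : SimpleGraph V)

/-- The expected number of neighbours of a vertex that signal on the first channel. -/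
noncomputable def load (ℓmax ℓ : V → ℕ) (v : V) : ℝ := ∑ u ∈ G.neighborFinset v, beepProb ℓmax ℓ u

variable {G}

theorem load_nonneg : 0 ≤ load G ℓmax ℓ v :=
  Finset.sum_nonneg fun _ _ => beepProb_nonneg

theorem measureReal_not_hears :
    (beepLaw ℓmax ℓ).real {b | ¬ Hears G b v} =
      ∏ u ∈ G.neighborFinset v, (1 - beepProb ℓmax ℓ u) := by
  rw [← measureReal_beepLaw_silent]
  congr 1
  ext b
  simp [Hears]

theorem measureReal_hears_le : (beepLaw ℓmax ℓ).real {b | Hears G b v} ≤ load G ℓmax ℓ v := by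
  have hset : {b : V → Prop | Hears G b v} = ⋃ u ∈ G.neighborFinset v, {b | b u} := by
    ext b
    simp [Hears]
  rw [hset]
  exact (measureReal_biUnion_finset_le _ _).trans_eq
    (Finset.sum_congr rfl fun u _ => measureReal_beepLaw_beep u)

theorem mul_prod_one_sub_beepProb_le_prod_union {ε : ℝ} {x : V} {L : Finset V}
    (hε : ε ≤ (beepLaw ℓmax ℓ).real {b | ¬ Hears G b x}) :
    ε * ∏ u ∈ L, (1 - beepProb ℓmax ℓ u) ≤
      ∏ u ∈ G.neighborFinset x ∪ L, (1 - beepProb ℓmax ℓ u) := by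
  rw [measureReal_not_hears] at hε
  rw [← Finset.sdiff_union_self_eq_union, Finset.prod_union Finset.sdiff_disjoint]
  refine mul_le_mul_of_nonneg_right (hε.trans ?_)
    (Finset.prod_nonneg fun _ _ => one_sub_beepProb_nonneg)
  exact Finset.prod_le_prod_of_subset_of_le_one Finset.sdiff_subset
    (fun _ _ => one_sub_beepProb_nonneg) fun _ _ _ => one_sub_beepProb_le_one

/- Order `L`: the events that the last beeping vertex of `L` is `x`, and that no neighbour of `x`
beeps, are disjoint, and conditioning on the silence of later vertices only helps `x`. -/
theorem mul_le_measureReal_exists_beep_alone {ε : ℝ} (L : Finset V)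
    (hL : ∀ u ∈ L, ε ≤ (beepLaw ℓmax ℓ).real {b | ¬ Hears G b u}) :
    ε * (1 - ∏ u ∈ L, (1 - beepProb ℓmax ℓ u)) ≤
      (beepLaw ℓmax ℓ).real {b | ∃ u ∈ L, b u ∧ ¬ Hears G b u} := by
  induction L using Finset.induction_on with
  | empty => simp
  | insert x L hx ih =>
    obtain ⟨hεx, hL⟩ := Finset.forall_mem_insert _ _ _ |>.1 hL
    set N := G.neighborFinset x
    have hsub : {b : V → Prop | ∃ u ∈ L, b u ∧ ¬ Hears G b u} ∪
        {b | b x ∧ ∀ u ∈ N ∪ L, ¬ b u} ⊆ {b | ∃ u ∈ insert x L, b u ∧ ¬ Hears G b u} := by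
      rintro b (⟨u, hu, h⟩ | ⟨hbx, hsilent⟩)
      · exact ⟨u, Finset.mem_insert_of_mem hu, h⟩
      · exact ⟨x, Finset.mem_insert_self _ _, hbx, fun ⟨u, hxu, hbu⟩ =>
          hsilent u (Finset.mem_union_left _ ((G.mem_neighborFinset _ _).2 hxu)) hbu⟩
    have hdisj : Disjoint {b : V → Prop | ∃ u ∈ L, b u ∧ ¬ Hears G b u}
        {b | b x ∧ ∀ u ∈ N ∪ L, ¬ b u} :=
      Set.disjoint_left.2 fun b ⟨u, hu, hbu, _⟩ ⟨_, hsilent⟩ =>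
        hsilent u (Finset.mem_union_right _ hu) hbu
    have hxN : x ∉ N ∪ L := by simp [N, hx]
    calc ε * (1 - ∏ u ∈ insert x L, (1 - beepProb ℓmax ℓ u))
        = ε * (1 - ∏ u ∈ L, (1 - beepProb ℓmax ℓ u)) +
          beepProb ℓmax ℓ x * (ε * ∏ u ∈ L, (1 - beepProb ℓmax ℓ u)) := by
          rw [Finset.prod_insert hx]
          ring
      _ ≤ (beepLaw ℓmax ℓ).real {b | ∃ u ∈ L, b u ∧ ¬ Hears G b u} +
          beepProb ℓmax ℓ x * ∏ u ∈ N ∪ L, (1 - beepProb ℓmax ℓ u) :=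
          add_le_add (ih hL) (mul_le_mul_of_nonneg_left
            (mul_prod_one_sub_beepProb_le_prod_union hεx) beepProb_nonneg)
      _ ≤ _ := by
          rw [← measureReal_beepLaw_beep_silent hxN,
            ← measureReal_union hdisj (Set.to_countable _).measurableSet]
          exact measureReal_mono hsub

end Beeps

section Drift

open scoped Classical

variable {V : Type*} {ℓmax ℓ : V → ℕ} {b : V → Prop} {u v : V}

theorem beepProb_nextLevel_le {G : SimpleGraph V} (h0 : ℓ u ≠ 0) (hle : ℓ u ≤ ℓmax u) :
    beepProb ℓmax (nextLevel G ℓmax ℓ b) u ≤ 2 * beepProb ℓmax ℓ u + 2 * (1 / 2) ^ ℓmax u := by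
  have hp : 0 ≤ beepProb ℓmax ℓ u := beepProb_nonneg
  by_cases hnext : 0 < nextLevel G ℓmax ℓ b u ∧ nextLevel G ℓmax ℓ b u < ℓmax u
  · have hpow : ((1 : ℝ) / 2) ^ (nextLevel G ℓmax ℓ b u + 1) ≤ (1 / 2) ^ ℓ u :=
      pow_le_pow_of_le_one (by norm_num) (by norm_num)
        (level_le_nextLevel_add_one hle hnext.1.ne')
    have hcurrent : ((1 : ℝ) / 2) ^ ℓ u ≤ beepProb ℓmax ℓ u + (1 / 2) ^ ℓmax u := by
      rcases hle.lt_or_eq with hlt | heq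
      · rw [beepProb, if_pos ⟨Nat.pos_of_ne_zero h0, hlt⟩]
        exact le_add_of_nonneg_right (by positivity)
      · rw [heq]
        exact le_add_of_nonneg_left hp
    rw [beepProb, if_pos hnext]
    rw [pow_succ] at hpow
    linarith
  · rw [beepProb, if_neg hnext]
    positivity

theorem beepProb_nextLevel_le_of_hears₁ {G : SimpleGraph V} (h0 : ℓ u ≠ 0) (h₁ : Hears G b u) :
    beepProb ℓmax (nextLevel G ℓmax ℓ b) u ≤ beepProb ℓmax ℓ u / 2 := by
  by_cases hnext : 0 < nextLevel G ℓmax ℓ b u ∧ nextLevel G ℓmax ℓ b u < ℓmax u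
  · have h₂ : ¬ Hears G (Beep₂ ℓ) u := fun h₂ => hnext.2.ne (nextLevel_of_hears₂ h₂)
    have hmin := nextLevel_of_hears₁ (ℓmax := ℓmax) h₂ h0 h₁
    have hsucc : nextLevel G ℓmax ℓ b u = ℓ u + 1 := by omega
    rw [beepProb, if_pos hnext, hsucc, beepProb, if_pos ⟨Nat.pos_of_ne_zero h0, by omega⟩,
      pow_succ, mul_one_div]
  · rw [beepProb, if_neg hnext]
    exact div_nonneg beepProb_nonneg zero_le_two

theorem beepProb_nextLevel_of_hears₂ {G : SimpleGraph V} (h₂ : Hears G (Beep₂ ℓ) u) :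
    beepProb ℓmax (nextLevel G ℓmax ℓ b) u = 0 := by
  rw [beepProb, nextLevel_of_hears₂ h₂, if_neg (by simp)]

variable [Fintype V] (G : SimpleGraph V)

/-- The vertex `u` is undecided and hears no signal on the first channel with probability bounded
below, so that it may well join the independent set if it signals. -/
def Quiet (ℓmax ℓ : V → ℕ) (u : V) : Prop :=
  ¬ Dominated G ℓ u ∧ 1 / 30 ≤ (beepLaw ℓmax ℓ).real {b | ¬ Hears G b u}

/-- The part of the load that comes from quiet neighbours. -/
noncomputable def quietLoad (ℓmax ℓ : V → ℕ) (v : V) : ℝ :=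
  ∑ u ∈ G.neighborFinset v with Quiet G ℓmax ℓ u, beepProb ℓmax ℓ u

/-- The load that the neighbours would have at their maximum levels, where they are in fact
silent: it bounds the load that may reappear when they leave these levels. -/
noncomputable def hiddenLoad (ℓmax : V → ℕ) (v : V) : ℝ :=
  ∑ u ∈ G.neighborFinset v, (1 / 2) ^ ℓmax u

variable {G}

theorem integral_beepProb_nextLevel_le_of_not_quiet (h0 : ℓ u ≠ 0) (hle : ℓ u ≤ ℓmax u)
    (hu : ¬ Quiet G ℓmax ℓ u) :
    ∫ b, beepProb ℓmax (nextLevel G ℓmax ℓ b) u ∂(beepLaw ℓmax ℓ) ≤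
      11 / 20 * beepProb ℓmax ℓ u + 2 * (1 / 2) ^ ℓmax u := by
  have hp : 0 ≤ beepProb ℓmax ℓ u := beepProb_nonneg
  have hhidden : (0 : ℝ) ≤ (1 / 2) ^ ℓmax u := by positivity
  by_cases hdom : Dominated G ℓ u
  · simp only [beepProb_nextLevel_of_hears₂ (hdom.resolve_left h0), integral_zero]
    positivity
  · have hsilent : (beepLaw ℓmax ℓ).real {b | ¬ Hears G b u} ≤ 1 / 30 :=
      (not_le.1 fun h => hu ⟨hdom, h⟩).le
    calc ∫ b, beepProb ℓmax (nextLevel G ℓmax ℓ b) u ∂(beepLaw ℓmax ℓ)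
        ≤ ∫ _, beepProb ℓmax ℓ u / 2 ∂(beepLaw ℓmax ℓ) +
          (3 / 2 * beepProb ℓmax ℓ u + 2 * (1 / 2) ^ ℓmax u) *
            (beepLaw ℓmax ℓ).real {b | ¬ Hears G b u} :=
          integral_le_integral_add_mul_measureReal .of_finite (integrable_const _)
            (Set.to_countable _).measurableSet
            (fun b hb => beepProb_nextLevel_le_of_hears₁ h0 (not_not.1 hb))
            fun b _ => by linarith [beepProb_nextLevel_le (G := G) (b := b) h0 hle]
      _ ≤ beepProb ℓmax ℓ u / 2 +
          (3 / 2 * beepProb ℓmax ℓ u + 2 * (1 / 2) ^ ℓmax u) * (1 / 30) := by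
          rw [integral_const, probReal_univ, one_smul]
          gcongr
      _ ≤ 11 / 20 * beepProb ℓmax ℓ u + 2 * (1 / 2) ^ ℓmax u := by linarith

theorem level_ne_zero_of_mem_neighborFinset (hv : ¬ Dominated G ℓ v)
    (hu : u ∈ G.neighborFinset v) : ℓ u ≠ 0 :=
  fun h => hv (Or.inr ⟨u, (G.mem_neighborFinset _ _).1 hu, h⟩)

theorem load_nextLevel_le (hle : ∀ v, ℓ v ≤ ℓmax v) (hv : ¬ Dominated G ℓ v) :
    load G ℓmax (nextLevel G ℓmax ℓ b) v ≤ 2 * load G ℓmax ℓ v + 2 * hiddenLoad G ℓmax v := by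
  rw [load, load, hiddenLoad, Finset.mul_sum, Finset.mul_sum, ← Finset.sum_add_distrib]
  exact Finset.sum_le_sum fun u hu =>
    beepProb_nextLevel_le (level_ne_zero_of_mem_neighborFinset hv hu) (hle u)

theorem integral_load_nextLevel_le (hle : ∀ v, ℓ v ≤ ℓmax v) (hv : ¬ Dominated G ℓ v) :
    ∫ b, load G ℓmax (nextLevel G ℓmax ℓ b) v ∂(beepLaw ℓmax ℓ) ≤
      11 / 20 * load G ℓmax ℓ v + 29 / 20 * quietLoad G ℓmax ℓ v + 2 * hiddenLoad G ℓmax v := by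
  simp only [load, quietLoad, hiddenLoad, Finset.sum_filter, Finset.mul_sum,
    ← Finset.sum_add_distrib]
  rw [integral_finsetSum _ fun u _ => .of_finite]
  refine Finset.sum_le_sum fun u hu => ?_
  have h0 := level_ne_zero_of_mem_neighborFinset hv hu
  split_ifs with hquiet
  · calc ∫ b, beepProb ℓmax (nextLevel G ℓmax ℓ b) u ∂(beepLaw ℓmax ℓ)
        ≤ ∫ _, (2 * beepProb ℓmax ℓ u + 2 * (1 / 2) ^ ℓmax u) ∂(beepLaw ℓmax ℓ) :=
          integral_mono .of_finite (integrable_const _) fun _ => beepProb_nextLevel_le h0 (hle u)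
      _ = 11 / 20 * beepProb ℓmax ℓ u + 29 / 20 * beepProb ℓmax ℓ u + 2 * (1 / 2) ^ ℓmax u := by
          rw [integral_const, probReal_univ, one_smul]
          ring
  · rw [mul_zero, add_zero]
    exact integral_beepProb_nextLevel_le_of_not_quiet h0 (hle u) hquiet

theorem le_measureReal_dominated_nextLevel_of_quietLoad (h : 1 / 900 ≤ quietLoad G ℓmax ℓ v) :
    1 / 30000 ≤ (beepLaw ℓmax ℓ).real {b | Dominated G (nextLevel G ℓmax ℓ b) v} := by
  set Q := {u ∈ G.neighborFinset v | Quiet G ℓmax ℓ u}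
  have hprod : ∏ u ∈ Q, (1 - beepProb ℓmax ℓ u) ≤ 900 / 901 :=
    calc ∏ u ∈ Q, (1 - beepProb ℓmax ℓ u) ≤ (1 + quietLoad G ℓmax ℓ v)⁻¹ :=
          prod_one_sub_le_inv_one_add_sum (fun _ _ => beepProb_nonneg)
            fun _ _ => sub_nonneg.1 one_sub_beepProb_nonneg
      _ ≤ (1 + 1 / 900)⁻¹ := inv_anti₀ (by norm_num) (by linarith)
      _ = 900 / 901 := by norm_num
  have hsub : {b | ∃ u ∈ Q, b u ∧ ¬ Hears G b u} ⊆
      {b | Dominated G (nextLevel G ℓmax ℓ b) v} := by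
    rintro b ⟨u, hu, hbu, h₁⟩
    obtain ⟨huv, hquiet⟩ := Finset.mem_filter.1 hu
    exact Or.inr ⟨u, (G.mem_neighborFinset _ _).1 huv,
      nextLevel_of_beep_alone (fun h₂ => hquiet.1 (Or.inr h₂)) hbu h₁⟩
  calc (1 / 30000 : ℝ) ≤ 1 / 30 * (1 - ∏ u ∈ Q, (1 - beepProb ℓmax ℓ u)) := by linarith
    _ ≤ (beepLaw ℓmax ℓ).real {b | ∃ u ∈ Q, b u ∧ ¬ Hears G b u} :=
        mul_le_measureReal_exists_beep_alone Q fun u hu => (Finset.mem_filter.1 hu).2.2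
    _ ≤ _ := measureReal_mono hsub

theorem le_measureReal_dominated_nextLevel_of_level_eq_one (hv : ¬ Dominated G ℓ v)
    (h1 : ℓ v = 1) (hmax : 1 < ℓmax v) :
    1 / 2 * (1 - load G ℓmax ℓ v) ≤
      (beepLaw ℓmax ℓ).real {b | Dominated G (nextLevel G ℓmax ℓ b) v} := by
  have hbeep : beepProb ℓmax ℓ v = 1 / 2 := by
    rw [beepProb, if_pos (by omega), h1, pow_one]
  have hsub : {b | b v ∧ ∀ u ∈ G.neighborFinset v, ¬ b u} ⊆
      {b | Dominated G (nextLevel G ℓmax ℓ b) v} := fun b ⟨hbv, hsilent⟩ =>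
    Or.inl (nextLevel_of_beep_alone (fun h₂ => hv (Or.inr h₂)) hbv
      fun ⟨u, hvu, hbu⟩ => hsilent u ((G.mem_neighborFinset _ _).2 hvu) hbu)
  have hcompl : (beepLaw ℓmax ℓ).real {b | ¬ Hears G b v} =
      1 - (beepLaw ℓmax ℓ).real {b | Hears G b v} :=
    probReal_compl_eq_one_sub (Set.to_countable _).measurableSet
  calc 1 / 2 * (1 - load G ℓmax ℓ v)
      ≤ 1 / 2 * (beepLaw ℓmax ℓ).real {b | ¬ Hears G b v} := by
        rw [hcompl]
        gcongr
        exact measureReal_hears_le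
    _ = (beepLaw ℓmax ℓ).real {b | b v ∧ ∀ u ∈ G.neighborFinset v, ¬ b u} := by
        rw [measureReal_beepLaw_beep_silent (G.notMem_neighborFinset_self v), hbeep,
          measureReal_not_hears]
    _ ≤ _ := measureReal_mono hsub

end Drift

section Potential

open scoped Classical

variable {V : Type*} [Fintype V] {ℓmax ℓ : V → ℕ} {b : V → Prop} {v : V} (G : SimpleGraph V)

/-- The progress measure of a vertex: it is small if the vertex is at a low level and has
little competition. -/
noncomputable def weight (ℓmax ℓ : V → ℕ) (v : V) : ℝ :=
  (6 / 5) ^ ℓ v * (1 + 10 * load G ℓmax ℓ v)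

/-- The progress measure of a vertex, set to zero once the vertex is decided. -/
noncomputable def aliveWeight (ℓmax ℓ : V → ℕ) (v : V) : ℝ :=
  if Dominated G ℓ v then 0 else weight G ℓmax ℓ v

variable {G}

theorem one_le_weight : 1 ≤ weight G ℓmax ℓ v :=
  one_le_mul_of_one_le_of_one_le (one_le_pow₀ (by norm_num))
    (by linarith [load_nonneg (G := G) (ℓmax := ℓmax) (ℓ := ℓ) (v := v)])

theorem aliveWeight_nonneg : 0 ≤ aliveWeight G ℓmax ℓ v := by
  unfold aliveWeight
  split_ifs
  exacts [le_rfl, zero_le_one.trans one_le_weight]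

theorem aliveWeight_le_weight : aliveWeight G ℓmax ℓ v ≤ weight G ℓmax ℓ v := by
  unfold aliveWeight
  split_ifs
  exacts [zero_le_one.trans one_le_weight, le_rfl]

theorem aliveWeight_nextLevel_le (hv : ¬ Dominated G ℓ v) :
    aliveWeight G ℓmax (nextLevel G ℓmax ℓ b) v ≤
      (6 / 5) ^ ℓ v * (6 / 5 * (1 + 10 * load G ℓmax (nextLevel G ℓmax ℓ b) v)) := by
  have hload : 0 ≤ load G ℓmax (nextLevel G ℓmax ℓ b) v := load_nonneg
  calc aliveWeight G ℓmax (nextLevel G ℓmax ℓ b) v ≤ weight G ℓmax (nextLevel G ℓmax ℓ b) v :=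
        aliveWeight_le_weight
    _ ≤ (6 / 5) ^ (ℓ v + 1) * (1 + 10 * load G ℓmax (nextLevel G ℓmax ℓ b) v) := by
        unfold weight
        gcongr
        · norm_num
        · exact nextLevel_le_level_add_one hv
    _ = _ := by rw [pow_succ, mul_assoc]

theorem aliveWeight_nextLevel_le_of_not_hears (hv : ¬ Dominated G ℓ v) (h2 : 2 ≤ ℓ v)
    (h₁ : ¬ Hears G b v) :
    aliveWeight G ℓmax (nextLevel G ℓmax ℓ b) v ≤
      (6 / 5) ^ ℓ v * (5 / 6 * (1 + 10 * load G ℓmax (nextLevel G ℓmax ℓ b) v)) := by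
  have hload : 0 ≤ load G ℓmax (nextLevel G ℓmax ℓ b) v := load_nonneg
  obtain ⟨h0, h₂⟩ := not_or.1 hv
  unfold aliveWeight
  split_ifs with hdom
  · positivity
  · have hb : ¬ b v := fun hb => hdom (Or.inl (nextLevel_of_beep_alone h₂ hb h₁))
    obtain ⟨k, hk⟩ := Nat.exists_eq_add_of_le' h2
    have hnext : nextLevel G ℓmax ℓ b v = k + 1 := by
      rw [nextLevel_of_silent h₂ h0 hb h₁, hk]
      omega
    rw [weight, hnext, hk, pow_succ _ (k + 1)]
    exact le_of_eq (by ring)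

theorem aliveWeight_nextLevel_le_three_mul (hle : ∀ v, ℓ v ≤ ℓmax v) (hv : ¬ Dominated G ℓ v)
    (hhidden : hiddenLoad G ℓmax v ≤ 1 / 256) :
    aliveWeight G ℓmax (nextLevel G ℓmax ℓ b) v ≤ 3 * weight G ℓmax ℓ v := by
  have hload : 0 ≤ load G ℓmax ℓ v := load_nonneg
  have hnext := load_nextLevel_le (b := b) hle hv
  calc aliveWeight G ℓmax (nextLevel G ℓmax ℓ b) v
      ≤ (6 / 5) ^ ℓ v * (6 / 5 * (1 + 10 * load G ℓmax (nextLevel G ℓmax ℓ b) v)) :=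
        aliveWeight_nextLevel_le hv
    _ ≤ (6 / 5) ^ ℓ v * (3 * (1 + 10 * load G ℓmax ℓ v)) :=
        mul_le_mul_of_nonneg_left (by linarith) (by positivity)
    _ = 3 * weight G ℓmax ℓ v := by rw [weight, mul_left_comm]

theorem integral_mul_one_add_load_nextLevel_le {A B : ℝ} (hA : 0 ≤ A) (hB : 0 ≤ B)
    (hle : ∀ v, ℓ v ≤ ℓmax v) (hv : ¬ Dominated G ℓ v) (hhidden : hiddenLoad G ℓmax v ≤ 1 / 256)
    (hquiet : quietLoad G ℓmax ℓ v ≤ 1 / 900) :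
    ∫ b, A * (B * (1 + 10 * load G ℓmax (nextLevel G ℓmax ℓ b) v)) ∂(beepLaw ℓmax ℓ) ≤
      A * (B * (11 / 10 + 11 / 2 * load G ℓmax ℓ v)) := by
  have hload := integral_load_nextLevel_le hle hv
  rw [integral_const_mul, integral_const_mul, integral_add (integrable_const _) .of_finite,
    integral_const, probReal_univ, one_smul, integral_const_mul]
  exact mul_le_mul_of_nonneg_left (mul_le_mul_of_nonneg_left (by linarith) hB) hA

theorem integral_aliveWeight_nextLevel_le_of_large_load (hle : ∀ v, ℓ v ≤ ℓmax v)
    (hv : ¬ Dominated G ℓ v) (hhidden : hiddenLoad G ℓmax v ≤ 1 / 256)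
    (hquiet : quietLoad G ℓmax ℓ v ≤ 1 / 900) (hload : 1 / 8 ≤ load G ℓmax ℓ v) :
    ∫ b, aliveWeight G ℓmax (nextLevel G ℓmax ℓ b) v ∂(beepLaw ℓmax ℓ) ≤
      24 / 25 * weight G ℓmax ℓ v := by
  calc ∫ b, aliveWeight G ℓmax (nextLevel G ℓmax ℓ b) v ∂(beepLaw ℓmax ℓ)
      ≤ ∫ b, (6 / 5) ^ ℓ v * (6 / 5 * (1 + 10 * load G ℓmax (nextLevel G ℓmax ℓ b) v))
          ∂(beepLaw ℓmax ℓ) :=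
        integral_mono .of_finite .of_finite fun _ => aliveWeight_nextLevel_le hv
    _ ≤ (6 / 5) ^ ℓ v * (6 / 5 * (11 / 10 + 11 / 2 * load G ℓmax ℓ v)) :=
        integral_mul_one_add_load_nextLevel_le (by positivity) (by norm_num) hle hv hhidden hquiet
    _ ≤ (6 / 5) ^ ℓ v * (24 / 25 * (1 + 10 * load G ℓmax ℓ v)) :=
        mul_le_mul_of_nonneg_left (by linarith) (by positivity)
    _ = 24 / 25 * weight G ℓmax ℓ v := by rw [weight, mul_left_comm]

theorem integral_aliveWeight_nextLevel_le_of_small_load (hle : ∀ v, ℓ v ≤ ℓmax v)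
    (hv : ¬ Dominated G ℓ v) (hhidden : hiddenLoad G ℓmax v ≤ 1 / 256)
    (hquiet : quietLoad G ℓmax ℓ v ≤ 1 / 900) (hload : load G ℓmax ℓ v ≤ 1 / 8) (h2 : 2 ≤ ℓ v) :
    ∫ b, aliveWeight G ℓmax (nextLevel G ℓmax ℓ b) v ∂(beepLaw ℓmax ℓ) ≤
      24 / 25 * weight G ℓmax ℓ v := by
  set d := load G ℓmax ℓ v
  have hd0 : 0 ≤ d := load_nonneg
  have hhears : ∀ b, aliveWeight G ℓmax (nextLevel G ℓmax ℓ b) v ≤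
      (6 / 5) ^ ℓ v * (5 / 6 * (1 + 10 * load G ℓmax (nextLevel G ℓmax ℓ b) v)) +
        (6 / 5) ^ ℓ v * (6 / 5 * (9 / 8 + 20 * d)) := fun b => by
    have hnext := load_nextLevel_le (b := b) hle hv
    have hnext0 : 0 ≤ load G ℓmax (nextLevel G ℓmax ℓ b) v := load_nonneg
    calc aliveWeight G ℓmax (nextLevel G ℓmax ℓ b) v
        ≤ (6 / 5) ^ ℓ v * (6 / 5 * (1 + 10 * load G ℓmax (nextLevel G ℓmax ℓ b) v)) :=
          aliveWeight_nextLevel_le hv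
      _ ≤ (6 / 5) ^ ℓ v * (6 / 5 * (9 / 8 + 20 * d)) :=
          mul_le_mul_of_nonneg_left (by linarith) (by positivity)
      _ ≤ _ := le_add_of_nonneg_left (by positivity)
  calc ∫ b, aliveWeight G ℓmax (nextLevel G ℓmax ℓ b) v ∂(beepLaw ℓmax ℓ)
      ≤ ∫ b, (6 / 5) ^ ℓ v * (5 / 6 * (1 + 10 * load G ℓmax (nextLevel G ℓmax ℓ b) v))
          ∂(beepLaw ℓmax ℓ) +
        (6 / 5) ^ ℓ v * (6 / 5 * (9 / 8 + 20 * d)) * (beepLaw ℓmax ℓ).real {b | Hears G b v} :=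
        integral_le_integral_add_mul_measureReal .of_finite .of_finite
          (Set.to_countable _).measurableSet
          (fun _ hb => aliveWeight_nextLevel_le_of_not_hears hv h2 hb) fun b _ => hhears b
    _ ≤ (6 / 5) ^ ℓ v * (5 / 6 * (11 / 10 + 11 / 2 * d)) +
        (6 / 5) ^ ℓ v * (6 / 5 * (9 / 8 + 20 * d)) * d :=
        add_le_add
          (integral_mul_one_add_load_nextLevel_le (by positivity) (by norm_num) hle hv hhidden
            hquiet)
          (mul_le_mul_of_nonneg_left measureReal_hears_le (by positivity))
    _ = (6 / 5) ^ ℓ v * (5 / 6 * (11 / 10 + 11 / 2 * d) + 6 / 5 * (9 / 8 + 20 * d) * d) := by ring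
    _ ≤ (6 / 5) ^ ℓ v * (24 / 25 * (1 + 10 * d)) :=
        mul_le_mul_of_nonneg_left
          (by nlinarith [mul_le_mul_of_nonneg_left hload hd0]) (by positivity)
    _ = 24 / 25 * weight G ℓmax ℓ v := by rw [weight, mul_left_comm]

/-- The exponent that flattens the progress measure so much that the rare event of a decision
outweighs the possible growth by a factor `3`. -/
noncomputable def potentialExponent : ℝ := 1 / 120000

/-- The factor by which the expected potential of a vertex shrinks in every round. -/
noncomputable def contraction : ℝ := 1 - potentialExponent / 25

theorem potentialExponent_pos : 0 < potentialExponent := by norm_num [potentialExponent]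

theorem potentialExponent_le_one : potentialExponent ≤ 1 := by norm_num [potentialExponent]

theorem contraction_pos : 0 < contraction := by norm_num [contraction, potentialExponent]

theorem contraction_lt_one : contraction < 1 := by norm_num [contraction, potentialExponent]

theorem rpow_potentialExponent_le_contraction :
    (24 / 25 : ℝ) ^ potentialExponent ≤ contraction := by
  have h := rpow_one_add_le_one_add_mul_self (s := -1 / 25) (by norm_num) potentialExponent_pos.le
    potentialExponent_le_one
  norm_num [contraction] at h ⊢
  linarith

theorem three_rpow_potentialExponent_mul_le_contraction :
    (3 : ℝ) ^ potentialExponent * (1 - 1 / 30000) ≤ contraction := by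
  have h := rpow_one_add_le_one_add_mul_self (s := 2) (by norm_num) potentialExponent_pos.le
    potentialExponent_le_one
  norm_num [contraction, potentialExponent] at h ⊢
  linarith

variable (G)

/-- A supermartingale that is zero once the vertex is decided and at least one before. -/
noncomputable def potential (ℓmax ℓ : V → ℕ) (v : V) : ℝ :=
  aliveWeight G ℓmax ℓ v ^ potentialExponent

variable {G}

theorem potential_of_dominated (hv : Dominated G ℓ v) : potential G ℓmax ℓ v = 0 := by
  rw [potential, aliveWeight, if_pos hv, Real.zero_rpow potentialExponent_pos.ne']

theorem potential_of_not_dominated (hv : ¬ Dominated G ℓ v) :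
    potential G ℓmax ℓ v = weight G ℓmax ℓ v ^ potentialExponent := by
  rw [potential, aliveWeight, if_neg hv]

theorem potential_nonneg : 0 ≤ potential G ℓmax ℓ v :=
  Real.rpow_nonneg aliveWeight_nonneg _

theorem one_le_potential (hv : ¬ Dominated G ℓ v) : 1 ≤ potential G ℓmax ℓ v := by
  rw [potential_of_not_dominated hv]
  exact Real.one_le_rpow one_le_weight potentialExponent_pos.le

theorem potential_le_weight : potential G ℓmax ℓ v ≤ weight G ℓmax ℓ v :=
  calc potential G ℓmax ℓ v ≤ weight G ℓmax ℓ v ^ potentialExponent :=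
        Real.rpow_le_rpow aliveWeight_nonneg aliveWeight_le_weight potentialExponent_pos.le
    _ ≤ weight G ℓmax ℓ v ^ (1 : ℝ) :=
        Real.rpow_le_rpow_of_exponent_le one_le_weight potentialExponent_le_one
    _ = weight G ℓmax ℓ v := Real.rpow_one _

theorem integral_potential_nextLevel_le_of_measureReal_dominated (hle : ∀ v, ℓ v ≤ ℓmax v)
    (hv : ¬ Dominated G ℓ v) (hhidden : hiddenLoad G ℓmax v ≤ 1 / 256)
    (h : 1 / 30000 ≤ (beepLaw ℓmax ℓ).real {b | Dominated G (nextLevel G ℓmax ℓ b) v}) :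
    ∫ b, potential G ℓmax (nextLevel G ℓmax ℓ b) v ∂(beepLaw ℓmax ℓ) ≤
      contraction * potential G ℓmax ℓ v := by
  rw [potential_of_not_dominated hv]
  calc ∫ b, potential G ℓmax (nextLevel G ℓmax ℓ b) v ∂(beepLaw ℓmax ℓ)
      ≤ 3 ^ potentialExponent * (1 - 1 / 30000) * weight G ℓmax ℓ v ^ potentialExponent :=
        integral_rpow_le_of_le_measureReal (fun _ => aliveWeight_nonneg) .of_finite
          potentialExponent_pos (by norm_num) (zero_le_one.trans one_le_weight)
          (Set.to_countable _).measurableSet (fun _ hb => if_pos hb) h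
          fun _ => aliveWeight_nextLevel_le_three_mul hle hv hhidden
    _ ≤ contraction * weight G ℓmax ℓ v ^ potentialExponent :=
        mul_le_mul_of_nonneg_right three_rpow_potentialExponent_mul_le_contraction
          (Real.rpow_nonneg (zero_le_one.trans one_le_weight) _)

theorem integral_potential_nextLevel_le_of_integral_aliveWeight (hv : ¬ Dominated G ℓ v)
    (h : ∫ b, aliveWeight G ℓmax (nextLevel G ℓmax ℓ b) v ∂(beepLaw ℓmax ℓ) ≤
      24 / 25 * weight G ℓmax ℓ v) :
    ∫ b, potential G ℓmax (nextLevel G ℓmax ℓ b) v ∂(beepLaw ℓmax ℓ) ≤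
      contraction * potential G ℓmax ℓ v := by
  have hweight : 0 ≤ weight G ℓmax ℓ v := zero_le_one.trans one_le_weight
  rw [potential_of_not_dominated hv]
  calc ∫ b, potential G ℓmax (nextLevel G ℓmax ℓ b) v ∂(beepLaw ℓmax ℓ)
      ≤ (24 / 25) ^ potentialExponent * weight G ℓmax ℓ v ^ potentialExponent :=
        integral_rpow_le_rpow_mul_rpow (fun _ => aliveWeight_nonneg) .of_finite .of_finite
          potentialExponent_pos.le potentialExponent_le_one (by norm_num) hweight h
    _ ≤ contraction * weight G ℓmax ℓ v ^ potentialExponent :=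
        mul_le_mul_of_nonneg_right rpow_potentialExponent_le_contraction
          (Real.rpow_nonneg hweight _)

/- Either `v` has a fair chance of being decided in the next round, by a quiet neighbour or by
itself from level `1`; or its competition vanishes or its level drops in expectation. -/
theorem integral_potential_nextLevel_le (hmax : 1 < ℓmax v) (hle : ∀ v, ℓ v ≤ ℓmax v)
    (hindep : G.IsIndepSet (zeroSet ℓ)) (hhidden : hiddenLoad G ℓmax v ≤ 1 / 256) :
    ∫ b, potential G ℓmax (nextLevel G ℓmax ℓ b) v ∂(beepLaw ℓmax ℓ) ≤
      contraction * potential G ℓmax ℓ v := by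
  by_cases hv : Dominated G ℓ v
  · simp only [potential_of_dominated hv, potential_of_dominated (hv.nextLevel hindep),
      integral_zero, mul_zero, le_refl]
  rcases le_total (1 / 900) (quietLoad G ℓmax ℓ v) with hquiet | hquiet
  · exact integral_potential_nextLevel_le_of_measureReal_dominated hle hv hhidden
      (le_measureReal_dominated_nextLevel_of_quietLoad hquiet)
  rcases le_total (1 / 8) (load G ℓmax ℓ v) with hload | hload
  · exact integral_potential_nextLevel_le_of_integral_aliveWeight hv
      (integral_aliveWeight_nextLevel_le_of_large_load hle hv hhidden hquiet hload)
  have h0 : ℓ v ≠ 0 := fun h0 => hv (Or.inl h0)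
  obtain h1 | h2 : ℓ v = 1 ∨ 2 ≤ ℓ v := by omega
  · have hdecided := le_measureReal_dominated_nextLevel_of_level_eq_one hv h1 hmax
    exact integral_potential_nextLevel_le_of_measureReal_dominated hle hv hhidden (by linarith)
  · exact integral_potential_nextLevel_le_of_integral_aliveWeight hv
      (integral_aliveWeight_nextLevel_le_of_small_load hle hv hhidden hquiet hload h2)

end Potential

section Markov

open ProbabilityTheory

variable {V : Type*}

/-- The information available after `t` rounds: the random numbers used in the rounds before
time `t`. -/
abbrev history (V : Type*) (t : ℕ) : MeasurableSpace (ℕ → V → unitInterval) :=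
  ⨆ s ∈ Set.Iio t, MeasurableSpace.comap (fun ω => ω s) inferInstance

theorem history_le (t : ℕ) : history V t ≤ MeasurableSpace.pi :=
  iSup₂_le fun s _ => (measurable_pi_apply s).comap_le

theorem history_mono : Monotone (history V) := fun _ _ h =>
  biSup_mono fun _ hs => hs.trans_le h

variable {G : SimpleGraph V} {ℓmax ℓ : V → ℕ}

section Measurability

variable [Finite V]

theorem measurable_step :
    Measurable fun q : (V → ℕ) × (V → unitInterval) => step G ℓmax q.1 q.2 :=
  measurable_from_prod_countable_right fun ℓ =>
    (Measurable.of_discrete (f := nextLevel G ℓmax ℓ)).comp (measurable_beep₁ ℓmax ℓ)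

theorem measurable_level_history (t : ℕ) :
    Measurable[history V t] fun ω => level G ℓmax ℓ ω t := by
  induction t with
  | zero => exact measurable_const
  | succ t ih =>
    have hround : Measurable[history V (t + 1)] fun ω : ℕ → V → unitInterval => ω t :=
      Measurable.of_comap_le (le_iSup₂_of_le t t.lt_succ_self le_rfl)
    exact measurable_step.comp ((ih.mono (history_mono t.le_succ) le_rfl).prodMk hround)

theorem measurable_level (t : ℕ) : Measurable fun ω => level G ℓmax ℓ ω t :=
  (measurable_level_history t).mono (history_le t) le_rfl

end Measurability

variable [Fintype V]

instance : IsProbabilityMeasure (randomness V) := by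
  unfold randomness
  infer_instance

theorem indepFun_level_apply (t : ℕ) :
    IndepFun (fun ω => level G ℓmax ℓ ω t) (fun ω => ω t) (randomness V) := by
  have hrounds : iIndepFun (fun (s : ℕ) (ω : ℕ → V → unitInterval) => ω s) (randomness V) :=
    iIndepFun_infinitePi (X := fun _ r => r) fun _ => measurable_id
  have hpast : Indep (history V t) (MeasurableSpace.comap (fun ω => ω t) inferInstance)
      (randomness V) := by
    simpa [history] using indep_iSup_of_disjoint (fun s => (measurable_pi_apply s).comap_le)
      hrounds (Set.disjoint_singleton_right.2 (Set.self_notMem_Iio (a := t)))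
  exact indep_of_indep_of_le_left hpast (measurable_level_history t).comap_le

theorem map_level_apply (t : ℕ) :
    (randomness V).map (fun ω => (level G ℓmax ℓ ω t, ω t)) =
      ((randomness V).map fun ω => level G ℓmax ℓ ω t).prod
        (Measure.pi fun _ : V => (volume : Measure unitInterval)) := by
  rw [(indepFun_iff_map_prod_eq_prod_map_map (measurable_level t).aemeasurable
    (measurable_pi_apply t).aemeasurable).1 (indepFun_level_apply t)]
  congr 1
  exact (measurePreserving_eval_infinitePi _ t).map_eq

theorem lintegral_level_succ (f : (V → ℕ) → ENNReal) (t : ℕ) :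
    ∫⁻ ω, f (level G ℓmax ℓ ω (t + 1)) ∂randomness V =
      ∫⁻ ω, ∫⁻ b, f (nextLevel G ℓmax (level G ℓmax ℓ ω t) b) ∂beepLaw ℓmax (level G ℓmax ℓ ω t)
        ∂randomness V := by
  have hf : Measurable f := .of_discrete
  have hstep : Measurable fun q : (V → ℕ) × (V → unitInterval) => f (step G ℓmax q.1 q.2) :=
    hf.comp measurable_step
  calc ∫⁻ ω, f (level G ℓmax ℓ ω (t + 1)) ∂randomness V
      = ∫⁻ q, f (step G ℓmax q.1 q.2) ∂(randomness V).map fun ω => (level G ℓmax ℓ ω t, ω t) :=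
        (lintegral_map hstep ((measurable_level t).prodMk (measurable_pi_apply t))).symm
    _ = ∫⁻ ω, ∫⁻ r, f (step G ℓmax (level G ℓmax ℓ ω t) r)
          ∂(Measure.pi fun _ : V => (volume : Measure unitInterval)) ∂randomness V := by
        rw [map_level_apply, lintegral_prod _ hstep.aemeasurable,
          lintegral_map .of_discrete (measurable_level t)]
    _ = _ := lintegral_congr fun ω => by
        rw [beepLaw, lintegral_map .of_discrete (measurable_beep₁ ..)]
        rfl

end Markov

section Decay

variable {V : Type*} [Fintype V] {G : SimpleGraph V} {ℓmax ℓ : V → ℕ}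

theorem lintegral_potential_level_succ_le (hmax : ∀ v, 1 < ℓmax v) (hle : ∀ v, ℓ v ≤ ℓmax v)
    {v : V} (hhidden : hiddenLoad G ℓmax v ≤ 1 / 256) {t : ℕ}
    (hindep : ∀ ω, G.IsIndepSet (zeroSet (level G ℓmax ℓ ω t))) :
    ∫⁻ ω, ENNReal.ofReal (potential G ℓmax (level G ℓmax ℓ ω (t + 1)) v) ∂randomness V ≤
      ENNReal.ofReal contraction *
        ∫⁻ ω, ENNReal.ofReal (potential G ℓmax (level G ℓmax ℓ ω t) v) ∂randomness V := by
  rw [lintegral_level_succ fun L => ENNReal.ofReal (potential G ℓmax L v),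
    ← lintegral_const_mul' _ _ ENNReal.ofReal_ne_top]
  refine lintegral_mono fun ω => ?_
  rw [← ofReal_integral_eq_lintegral_ofReal .of_finite
      (Filter.Eventually.of_forall fun _ => potential_nonneg),
    ← ENNReal.ofReal_mul contraction_pos.le]
  exact ENNReal.ofReal_le_ofReal (integral_potential_nextLevel_le (hmax v)
    (level_le (fun u => zero_lt_one.trans (hmax u)) hle ω t) (hindep ω) hhidden)

theorem weight_le (hle : ∀ v, ℓ v ≤ ℓmax v) (v : V) :
    weight G ℓmax ℓ v ≤ (6 / 5) ^ ℓmax v * (1 + 10 * Fintype.card V) := by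
  have hload : load G ℓmax ℓ v ≤ Fintype.card V := by
    refine (Finset.sum_le_card_nsmul _ _ 1 fun u _ =>
      beepProb_le_half.trans (by norm_num)).trans ?_
    rw [nsmul_one]
    exact_mod_cast Finset.card_le_univ _
  have hload0 := load_nonneg (G := G) (ℓmax := ℓmax) (ℓ := ℓ) (v := v)
  unfold weight
  gcongr
  exacts [by norm_num, hle v]

theorem lintegral_potential_level_le (hmax : ∀ v, 1 < ℓmax v) (hle : ∀ v, ℓ v ≤ ℓmax v)
    {v : V} (hhidden : hiddenLoad G ℓmax v ≤ 1 / 256) (t : ℕ) :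
    ∫⁻ ω, ENNReal.ofReal (potential G ℓmax (level G ℓmax ℓ ω (t + 1)) v) ∂randomness V ≤
      ENNReal.ofReal (contraction ^ t * ((6 / 5) ^ ℓmax v * (1 + 10 * Fintype.card V))) := by
  have hpos : ∀ v, 0 < ℓmax v := fun u => zero_lt_one.trans (hmax u)
  induction t with
  | zero =>
    have hbound : ∀ ω, ENNReal.ofReal (potential G ℓmax (level G ℓmax ℓ ω 1) v) ≤
        ENNReal.ofReal ((6 / 5) ^ ℓmax v * (1 + 10 * Fintype.card V)) := fun ω =>
      ENNReal.ofReal_le_ofReal (potential_le_weight.trans (weight_le (level_le hpos hle ω 1) v))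
    simpa using lintegral_mono (μ := randomness V) hbound
  | succ t ih =>
    calc _ ≤ _ := lintegral_potential_level_succ_le hmax hle hhidden fun _ =>
          isIndepSet_zeroSet_nextLevel hpos
      _ ≤ _ := mul_le_mul_right ih _
      _ = _ := by rw [← ENNReal.ofReal_mul contraction_pos.le, pow_succ', mul_assoc]

theorem measure_not_dominated_level_le (hmax : ∀ v, 1 < ℓmax v) (hle : ∀ v, ℓ v ≤ ℓmax v)
    {v : V} (hhidden : hiddenLoad G ℓmax v ≤ 1 / 256) (t : ℕ) :
    randomness V {ω | ¬ Dominated G (level G ℓmax ℓ ω (t + 1)) v} ≤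
      ENNReal.ofReal (contraction ^ t * ((6 / 5) ^ ℓmax v * (1 + 10 * Fintype.card V))) := by
  have hmeas : Measurable fun ω =>
      ENNReal.ofReal (potential G ℓmax (level G ℓmax ℓ ω (t + 1)) v) :=
    (Measurable.of_discrete (f := fun L => ENNReal.ofReal (potential G ℓmax L v))).comp
      (measurable_level (t + 1))
  calc randomness V {ω | ¬ Dominated G (level G ℓmax ℓ ω (t + 1)) v}
      ≤ randomness V {ω | 1 ≤ ENNReal.ofReal (potential G ℓmax (level G ℓmax ℓ ω (t + 1)) v)} :=
        measure_mono fun ω hω => ENNReal.one_le_ofReal.2 (one_le_potential hω)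
    _ ≤ ∫⁻ ω, ENNReal.ofReal (potential G ℓmax (level G ℓmax ℓ ω (t + 1)) v) ∂randomness V := by
        simpa using mul_meas_ge_le_lintegral hmeas 1
    _ ≤ _ := lintegral_potential_level_le hmax hle hhidden t

theorem measure_not_stabilizedBy_le (hmax : ∀ v, 1 < ℓmax v) (hle : ∀ v, ℓ v ≤ ℓmax v)
    (hhidden : ∀ v, hiddenLoad G ℓmax v ≤ 1 / 256) (t : ℕ) :
    randomness V {ω | ¬ StabilizedBy G ℓmax (level G ℓmax ℓ ω) (t + 2)} ≤
      ∑ v, ENNReal.ofReal (contraction ^ t * ((6 / 5) ^ ℓmax v * (1 + 10 * Fintype.card V))) := by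
  have hpos : ∀ v, 0 < ℓmax v := fun u => zero_lt_one.trans (hmax u)
  have hsub : {ω | ¬ StabilizedBy G ℓmax (level G ℓmax ℓ ω) (t + 2)} ⊆
      ⋃ v ∈ (Finset.univ : Finset V), {ω | ¬ Dominated G (level G ℓmax ℓ ω (t + 1)) v} := by
    intro ω hω
    simp only [Finset.mem_univ, Set.iUnion_true, Set.mem_iUnion, Set.mem_ofPred_eq]
    by_contra! hdom
    have hmis : Maximal G.IsIndepSet (zeroSet (level G ℓmax ℓ ω (t + 1))) :=
      maximal_isIndepSet_zeroSet_iff.2 ⟨isIndepSet_zeroSet_nextLevel hpos, hdom⟩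
    exact hω ((stabilizedBy_of_maximal_zeroSet hpos hmis).mono (by push_cast; linarith))
  calc _ ≤ ∑ v, randomness V {ω | ¬ Dominated G (level G ℓmax ℓ ω (t + 1)) v} :=
        (measure_mono hsub).trans (measure_biUnion_finset_le _ _)
    _ ≤ _ := Finset.sum_le_sum fun v _ => measure_not_dominated_level_le hmax hle (hhidden v) t

end Decay

section MaximumLevels

variable {V : Type*} [Fintype V] {G : SimpleGraph V} {ℓmax : V → ℕ}

theorem logb_two_natCast_nonneg (k : ℕ) : 0 ≤ Real.logb 2 k :=
  div_nonneg (Real.log_natCast_nonneg k) (Real.log_nonneg one_le_two)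

open scoped Classical in
theorem degree_le_deg₂ {u v : V} (h : G.Adj u v) : G.degree v ≤ deg₂ G u :=
  Finset.le_sup (f := fun u => G.degree u)
    (Finset.mem_insert_of_mem ((G.mem_neighborFinset u v).2 h))

open scoped Classical in
theorem hiddenLoad_le {c : ℝ} (h : ∀ v, Real.logb 2 (deg₂ G v) + c ≤ ℓmax v) (v : V) :
    hiddenLoad G ℓmax v ≤ 2 ^ (-c) := by
  have hterm : ∀ u ∈ G.neighborFinset v, (1 / 2 : ℝ) ^ ℓmax u ≤ 2 ^ (-c) / G.degree v := by
    intro u hu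
    have huv : G.Adj v u := (G.mem_neighborFinset v u).1 hu
    have hdeg : 0 < G.degree v := (G.degree_pos_iff_exists_adj v).2 ⟨u, huv⟩
    have hdeg₂ : G.degree v ≤ deg₂ G u := degree_le_deg₂ huv.symm
    have hdeg₂pos : (0 : ℝ) < deg₂ G u := by exact_mod_cast hdeg.trans_le hdeg₂
    calc (1 / 2 : ℝ) ^ ℓmax u = 2 ^ (-(ℓmax u : ℝ)) := by
          rw [Real.rpow_neg zero_le_two, Real.rpow_natCast, one_div, inv_pow]
      _ ≤ 2 ^ (-c - Real.logb 2 (deg₂ G u)) :=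
          Real.rpow_le_rpow_of_exponent_le one_le_two (by linarith [h u])
      _ = 2 ^ (-c) / deg₂ G u := by
          rw [Real.rpow_sub two_pos, Real.rpow_logb two_pos (by norm_num) hdeg₂pos]
      _ ≤ 2 ^ (-c) / G.degree v := by gcongr
  calc hiddenLoad G ℓmax v ≤ G.degree v • ((2 : ℝ) ^ (-c) / G.degree v) :=
        Finset.sum_le_card_nsmul _ _ _ hterm
    _ ≤ 2 ^ (-c) := by
        rw [nsmul_eq_mul, mul_div_left_comm]
        exact mul_le_of_le_one_right (by positivity) (div_self_le_one _)

theorem contraction_pow_mul_le {c a n : ℝ} {m t : ℕ} (hn : 2 ≤ n)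
    (hm : (m : ℝ) ≤ c * Real.logb 2 n)
    (ht : (c + a + 6) / -Real.logb 2 contraction * Real.logb 2 n ≤ t) :
    contraction ^ t * ((6 / 5) ^ m * (1 + 10 * n)) ≤ n ^ (-a) / n := by
  have hn0 : 0 < n := by linarith
  have hdecay : contraction ^ t ≤ n ^ (-(c + a + 6)) :=
    pow_le_rpow_neg_of_div_logb_mul_le contraction_pos contraction_lt_one hn0 ht
  have hlevel : (6 / 5 : ℝ) ^ m ≤ n ^ c :=
    (pow_le_pow_left₀ (by norm_num) (by norm_num) m).trans (two_pow_le_rpow_of_le_mul_logb hn0 hm)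
  have hload : 1 + 10 * n ≤ n ^ (5 : ℝ) := by
    have hpow : 2 ^ 4 ≤ n ^ 4 := pow_le_pow_left₀ two_pos.le hn 4
    rw [show (5 : ℝ) = (5 : ℕ) by norm_num, Real.rpow_natCast]
    nlinarith
  calc contraction ^ t * ((6 / 5) ^ m * (1 + 10 * n))
      ≤ n ^ (-(c + a + 6)) * (n ^ c * n ^ (5 : ℝ)) := by
        gcongr
    _ = n ^ (-a) / n := by
        rw [← Real.rpow_add hn0, ← Real.rpow_add hn0, ← Real.rpow_sub_one hn0.ne']
        congr 1
        ring

theorem two_le_card_of_le_mul_logb {c : ℝ} {v : V} (hpos : 0 < ℓmax v)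
    (h : (ℓmax v : ℝ) ≤ c * Real.logb 2 (Fintype.card V)) : 2 ≤ Fintype.card V := by
  by_contra! hlt
  have hcard : Fintype.card V = 1 := by
    have := Fintype.card_pos_iff.2 ⟨v⟩
    omega
  rw [hcard, Nat.cast_one, Real.logb_one, mul_zero] at h
  exact hpos.not_ge (by exact_mod_cast h)

end MaximumLevels

end TwoChannelMIS

open TwoChannelMIS in
theorem corollary3_general (c₂ a : ℝ) (hc₂ : 0 < c₂) (ha : 0 < a) :
    ∃ M : ℝ, 0 < M ∧
      ∀ (V : Type*) [Fintype V] (G : SimpleGraph V) (ℓmax : V → ℕ),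
        (∀ v, Real.logb 2 (deg₂ G v) + 8 ≤ ℓmax v ∧
          (ℓmax v : ℝ) ≤ c₂ * Real.logb 2 (Fintype.card V)) →
        ∀ ℓ₀ : V → ℕ, (∀ v, ℓ₀ v ≤ ℓmax v) →
          randomness V {ω | ¬ StabilizedBy G ℓmax (level G ℓmax ℓ₀ ω)
            (M * Real.logb 2 (Fintype.card V))} ≤
            ENNReal.ofReal ((Fintype.card V : ℝ) ^ (-a)) := by
  set K : ℝ := (c₂ + a + 6) / -Real.logb 2 contraction
  have hK : 0 < K := div_pos (by positivity)
    (neg_pos.2 (Real.logb_neg one_lt_two contraction_pos contraction_lt_one))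
  refine ⟨K + 3, by positivity, fun V _ G ℓmax h ℓ₀ hle => ?_⟩
  rcases isEmpty_or_nonempty V with hV | ⟨⟨v₀⟩⟩
  · simp [StabilizedBy.of_isEmpty]
  have hmax : ∀ v, 1 < ℓmax v := fun v => by
    have hlog := logb_two_natCast_nonneg (deg₂ G v)
    exact_mod_cast (show (1 : ℝ) < ℓmax v by linarith [(h v).1])
  have hhidden : ∀ v, hiddenLoad G ℓmax v ≤ 1 / 256 := fun v =>
    (hiddenLoad_le (fun u => (h u).1) v).trans_eq (by norm_num)
  set n : ℝ := (Fintype.card V : ℝ)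
  have hn : 2 ≤ n := Nat.ofNat_le_cast.2
    (two_le_card_of_le_mul_logb (zero_lt_one.trans (hmax v₀)) (h v₀).2)
  have hlog : 1 ≤ Real.logb 2 n :=
    (Real.le_logb_iff_rpow_le one_lt_two (by linarith)).2 (by simpa using hn)
  set T : ℕ := ⌈K * Real.logb 2 n⌉₊
  have hT : (T : ℝ) + 2 ≤ (K + 3) * Real.logb 2 n := by
    linarith [Nat.ceil_lt_add_one (show 0 ≤ K * Real.logb 2 n by positivity)]
  calc randomness V {ω | ¬ StabilizedBy G ℓmax (level G ℓmax ℓ₀ ω) ((K + 3) * Real.logb 2 n)}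
      ≤ randomness V {ω | ¬ StabilizedBy G ℓmax (level G ℓmax ℓ₀ ω) (T + 2)} :=
        measure_mono fun ω hω hstab => hω (hstab.mono hT)
    _ ≤ ∑ v, ENNReal.ofReal (contraction ^ T * ((6 / 5) ^ ℓmax v * (1 + 10 * n))) :=
        measure_not_stabilizedBy_le hmax hle hhidden T
    _ ≤ ∑ _v : V, ENNReal.ofReal (n ^ (-a) / n) := Finset.sum_le_sum fun v _ =>
        ENNReal.ofReal_le_ofReal (contraction_pow_mul_le hn (h v).2 (Nat.le_ceil _))
    _ = ENNReal.ofReal (n ^ (-a)) := by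
        rw [Finset.sum_const, nsmul_eq_mul, Finset.card_univ, ← ENNReal.ofReal_natCast,
          ← ENNReal.ofReal_mul (by positivity), mul_div_cancel₀ _ (by positivity)]

theorem corollary3 (c₁ c₂ a : ℝ) (hc₁ : 15 ≤ c₁) (hc₂ : 0 < c₂) (ha : 0 < a) :
    ∃ M : ℝ, 0 < M ∧
      ∀ (V : Type*) [Fintype V] (G : SimpleGraph V) (ℓmax : V → ℕ),
        (∀ v, 2 * Real.logb 2 (TwoChannelMIS.deg₂ G v) + c₁ ≤ ℓmax v ∧
          (ℓmax v : ℝ) ≤ c₂ * Real.logb 2 (Fintype.card V)) →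
        ∀ ℓ₀ : V → ℕ, (∀ v, ℓ₀ v ≤ ℓmax v) →
          TwoChannelMIS.randomness V {ω | ¬ TwoChannelMIS.StabilizedBy G ℓmax
            (TwoChannelMIS.level G ℓmax ℓ₀ ω) (M * Real.logb 2 (Fintype.card V))} ≤
            ENNReal.ofReal ((Fintype.card V : ℝ) ^ (-a)) := by
  obtain ⟨M, hM, hstab⟩ := corollary3_general c₂ a hc₂ ha
  refine ⟨M, hM, fun V _ G ℓmax h => hstab V G ℓmax fun v => ⟨?_, (h v).2⟩⟩
  linarith [(h v).1, TwoChannelMIS.logb_two_natCast_nonneg (TwoChannelMIS.deg₂ G v)]
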